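/- For integers $s_1,\dots,s_r\ge 1$ with $s_r>1$, let $$\zeta(s_1,\dots,s_r)=\sum_{1\le k_1<k_2<\cdots<k_r}\frac{1}{k_1^{s_1}k_2^{s_2}\cdots k_r^{s_r}},$$ let $\{2\}^d$ denote the sequence $2,2,\dots,2$ of length $d$, and let $\zeta(2n)$ be the value of the Riemann zeta function, so that $\zeta(0)=-\tfrac12$. Then for all nonnegative integers $a$ and $b$ the multiple series defining $\zeta(\{2\}^a,3,\{2\}^b)$ and the series on the right-hand side below converge absolutely, and $$\zeta(\{2\}^a,3,\{2\}^b)=\frac{-4\pi^{2a+2b+2}}{(2a+2)!}\sum_{n=0}^{\infty}\frac{\zeta(2n)}{(2n+2a+2)(2n+2a+3)\cdots(2n+2a+2b+3)\,2^{2n}},$$ where the factors $(2n+2a+2)(2n+2a+3)\cdots(2n+2a+2b+3)$ are the $2b+2$ consecutive integers from $2n+2a+2$ to $2n+2a+2b+3$. -/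

import Mathlib

/-- The index set of the multiple zeta series of depth `r`: strictly increasing `r`-tuples
`1 ≤ k₁ < k₂ < ⋯ < k_r` of positive integers. -/
abbrev MZVIndex (r : ℕ) : Type :=
  {k : Fin r → ℕ // (∀ i, 1 ≤ k i) ∧ StrictMono k}

/-- The summand `1 / (k₁ ^ s₁ * ⋯ * k_r ^ s_r)` for `s = [s₁, …, s_r]`. -/
noncomputable def mzvTerm (s : List ℕ) (k : MZVIndex s.length) : ℝ :=
  1 / ∏ i : Fin s.length, (k.1 i : ℝ) ^ s.get i

/-- The multiple zeta value
`ζ(s₁, …, s_r) = ∑_{1 ≤ k₁ < ⋯ < k_r} 1 / (k₁ ^ s₁ * ⋯ * k_r ^ s_r)`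
(the largest summation variable carries the last exponent). -/
noncomputable def multipleZeta (s : List ℕ) : ℝ :=
  ∑' k : MZVIndex s.length, mzvTerm s k

/-- The index `({2}^a, 3, {2}^b)`. -/
def twosThreeTwos (a b : ℕ) : List ℕ :=
  List.replicate a 2 ++ [3] ++ List.replicate b 2

/-- The summand
`ζ(2n) / ((2n+2a+2)(2n+2a+3)⋯(2n+2a+2b+3) 2^{2n})`; the denominator is the product of the
`2b+2` consecutive integers from `2n+2a+2` to `2n+2a+2b+3`, and `ζ` is the Riemann zeta function
(so `ζ(0) = -1/2`). -/
noncomputable def lupuTerm (a b n : ℕ) : ℂ :=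
  riemannZeta (2 * (n : ℂ)) /
    ((∏ j ∈ Finset.Icc (2 * n + 2 * a + 2) (2 * n + 2 * a + 2 * b + 3), (j : ℂ)) *
      2 ^ (2 * n))

/-!
The two sides are compared with one integral,
`cotIntegral a b = 2 / π * ∫ (2x) ^ (2a + 2) / (2a + 2)! * cot x * (π - 2x) ^ (2b + 1) / (2b + 1)!`
over `[0, π / 2]`.

Group the multiple zeta series by the index `k` carrying the exponent `3`: it becomes
`∑ F_a(k) G_b(k) / k ^ 3`, where `F_a(k)` is the multiple sum of inverse squares over `a` increasing
indices below `k` and `G_b(k)` the one over `b` increasing indices above `k`.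

* `G_b(k)` is the mean of `(π - 2x) ^ (2b) / (2b)!` for the density proportional to `sin x ^ (2k)`.
  Integrating by parts twice gives the recursion `G_b(k - 1) = G_b(k) + G_{b-1}(k) / k ^ 2`
  (`sinMoment_succ_left`), and the means tend to `0` because the densities concentrate at `π / 2`
  (`tendsto_sinMoment_succ`).
* `F_a(k)` is a coefficient of the expansion
  `(2x) ^ (2a + 2) / (2a + 2)! = ∑ F_a(k) 4 ^ k / (k ^ 2 binom(2k, k)) sin x ^ (2k)`.
  The remainders of this expansion satisfy a second order recursion in `a`, which shows that they
  are nonnegative and tend to `0` (`sinRemainder_spec`).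

Multiplying the expansion by `cot x * (π - 2x) ^ (2b + 1) / (2b + 1)!` and integrating term by term
gives the multiple zeta value (`hasSum_headSum_mul_sinMoment`). On the other side, the reciprocal of
a product of consecutive integers is a Beta integral, and `∑ ζ(2n) x ^ (2n) = -(πx / 2) cot (πx)`
(`hasSum_evenZeta_mul_pow`) turns the zeta series into the same integral (`hasSum_lupuTerm`).

The multiple series is rearranged in `ℝ≥0∞` (`tupleSum_cons`, `iterate_tailSum`), so that absolute
convergence comes out of the computation.
-/

open Real Filter Topology
open scoped ENNReal

/-! ### Divided powers and Wallis weights -/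

/-- The divided power `x ^ n / n!`. -/
noncomputable def dividedPow (n : ℕ) (x : ℝ) : ℝ := x ^ n / (n.factorial : ℝ)

lemma dividedPow_zero_left (x : ℝ) : dividedPow 0 x = 1 := by simp [dividedPow]

lemma dividedPow_succ_zero (n : ℕ) : dividedPow (n + 1) 0 = 0 := by simp [dividedPow]

lemma dividedPow_nonneg (n : ℕ) {x : ℝ} (hx : 0 ≤ x) : 0 ≤ dividedPow n x := by
  unfold dividedPow; positivity

lemma continuous_dividedPow (n : ℕ) : Continuous (dividedPow n) := by
  unfold dividedPow; fun_prop

lemma hasDerivAt_dividedPow (n : ℕ) (x : ℝ) :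
    HasDerivAt (dividedPow (n + 1)) (dividedPow n x) x := by
  have h := (hasDerivAt_pow (n + 1) x).div_const ((n + 1).factorial : ℝ)
  refine h.congr_deriv ?_
  have : (n.factorial : ℝ) ≠ 0 := by positivity
  rw [dividedPow, Nat.factorial_succ]
  push_cast
  field_simp

lemma hasDerivAt_dividedPow_two_mul (n : ℕ) (x : ℝ) :
    HasDerivAt (fun t => dividedPow (n + 1) (2 * t)) (2 * dividedPow n (2 * x)) x := by
  have h : HasDerivAt (fun t : ℝ => 2 * t) 2 x := by
    simpa using (hasDerivAt_id x).const_mul (2 : ℝ)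
  exact ((hasDerivAt_dividedPow n (2 * x)).comp x h).congr_deriv (by ring)

lemma hasDerivAt_dividedPow_pi_sub (n : ℕ) (x : ℝ) :
    HasDerivAt (fun t => dividedPow (n + 1) (π - 2 * t)) (-2 * dividedPow n (π - 2 * x)) x := by
  have h : HasDerivAt (fun t : ℝ => π - 2 * t) (-2) x := by
    simpa using ((hasDerivAt_id x).const_mul (2 : ℝ)).const_sub π
  have h' := HasDerivAt.comp x (hasDerivAt_dividedPow n (π - 2 * x)) h
  exact h'.congr_deriv (by ring)

/-- The reciprocal `4 ^ k / binom(2k, k)` of the mean value of `sin ^ (2k)`. -/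
noncomputable def wallisWeight (k : ℕ) : ℝ := 4 ^ k / (k.centralBinom : ℝ)

lemma wallisWeight_pos (k : ℕ) : 0 < wallisWeight k := by
  have : (0 : ℝ) < k.centralBinom := by exact_mod_cast k.centralBinom_pos
  unfold wallisWeight; positivity

lemma wallisWeight_zero : wallisWeight 0 = 1 := by simp [wallisWeight]

lemma wallisWeight_succ (k : ℕ) :
    wallisWeight (k + 1) * (2 * k + 1) = wallisWeight k * (2 * k + 2) := by
  have h0 : (0 : ℝ) < k.centralBinom := by exact_mod_cast k.centralBinom_pos
  have h1 : (0 : ℝ) < (k + 1).centralBinom := by exact_mod_cast (k + 1).centralBinom_pos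
  have h2 : ((k : ℝ) + 1) * (k + 1).centralBinom = 2 * (2 * k + 1) * k.centralBinom := by
    exact_mod_cast Nat.succ_mul_centralBinom_succ k
  unfold wallisWeight
  rw [div_mul_eq_mul_div, div_mul_eq_mul_div, div_eq_div_iff h1.ne' h0.ne', pow_succ]
  linear_combination (-2 * 4 ^ k : ℝ) * h2

lemma wallisWeight_le (k : ℕ) : wallisWeight k ≤ 2 * k + 1 := by
  induction k with
  | zero => simp [wallisWeight]
  | succ k ih =>
    have h := wallisWeight_succ k
    have hp := wallisWeight_pos k
    have : wallisWeight (k + 1) = wallisWeight k * (2 * k + 2) / (2 * k + 1) := by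
      rw [eq_div_iff (by positivity), h]
    rw [this, div_le_iff₀ (by positivity)]
    push_cast
    nlinarith

/-! ### Moments of even powers of the sine and tails of multiple sums -/

lemma hasDerivAt_sin_pow (n : ℕ) (x : ℝ) :
    HasDerivAt (fun t => sin t ^ (n + 1)) ((n + 1) * sin x ^ n * cos x) x := by
  refine HasDerivAt.congr_deriv ((hasDerivAt_sin x).pow (n + 1)) ?_
  simp

lemma hasDerivAt_sin_pow_mul_cos (k : ℕ) (x : ℝ) :
    HasDerivAt (fun t => (2 * k + 2) * sin t ^ (2 * k + 1) * cos t)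
      ((2 * k + 2) * (2 * k + 1) * sin x ^ (2 * k) - (2 * k + 2) ^ 2 * sin x ^ (2 * k + 2)) x := by
  have h := ((hasDerivAt_sin_pow (2 * k) x).const_mul (2 * k + 2 : ℝ)).mul (hasDerivAt_cos x)
  refine h.congr_deriv ?_
  push_cast
  have hc : cos x ^ 2 = 1 - sin x ^ 2 := by rw [← sin_sq_add_cos_sq x]; ring
  linear_combination ((2 * k + 2) * (2 * k + 1) * sin x ^ (2 * k)) * hc

/-- Two integrations by parts; every boundary term vanishes, at `0` because of the sine, at `π / 2`
because of the cosine or by the hypothesis on `p'`. -/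
lemma integral_sin_pow_by_parts (k : ℕ) {p p' p'' : ℝ → ℝ} (hp : ∀ x, HasDerivAt p (p' x) x)
    (hp' : ∀ x, HasDerivAt p' (p'' x) x) (hc : Continuous p'') (h0 : p' (π / 2) = 0) :
    (2 * k + 2) * (2 * k + 1) * (∫ x in (0 : ℝ)..π / 2, sin x ^ (2 * k) * p x) =
      (2 * k + 2) ^ 2 * (∫ x in (0 : ℝ)..π / 2, sin x ^ (2 * k + 2) * p x) +
        ∫ x in (0 : ℝ)..π / 2, sin x ^ (2 * k + 2) * p'' x := by
  have cp : Continuous p := continuous_iff_continuousAt.2 fun x => (hp x).continuousAt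
  have hd : ∀ x, HasDerivAt
      (fun t => (2 * k + 2) * sin t ^ (2 * k + 1) * cos t * p t - sin t ^ (2 * k + 2) * p' t)
      ((2 * k + 2) * (2 * k + 1) * (sin x ^ (2 * k) * p x) -
        (2 * k + 2) ^ 2 * (sin x ^ (2 * k + 2) * p x) - sin x ^ (2 * k + 2) * p'' x) x := by
    intro x
    refine (((hasDerivAt_sin_pow_mul_cos k x).mul (hp x)).sub
      ((hasDerivAt_sin_pow (2 * k + 1) x).mul (hp' x))).congr_deriv ?_
    push_cast
    ring
  have h := intervalIntegral.integral_eq_sub_of_hasDerivAt (a := 0) (b := π / 2)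
    (fun x _ => hd x) (Continuous.intervalIntegrable (by fun_prop) _ _)
  rw [intervalIntegral.integral_sub, intervalIntegral.integral_sub,
    intervalIntegral.integral_const_mul, intervalIntegral.integral_const_mul] at h
  · simp [h0] at h
    linarith
  all_goals exact Continuous.intervalIntegrable (by fun_prop) _ _

/-- The mean of `(π - 2x) ^ (2b) / (2b)!` against the probability density on `[0, π / 2]`
proportional to `sin x ^ (2k)`. It is equal to `∑ 1 / (k₁ ⋯ k_b) ^ 2` over
`k < k₁ < ⋯ < k_b`. -/
noncomputable def sinMoment (b k : ℕ) : ℝ :=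
  2 / π * wallisWeight k * ∫ x in (0 : ℝ)..π / 2, sin x ^ (2 * k) * dividedPow (2 * b) (π - 2 * x)

lemma sinMoment_zero_left (k : ℕ) : sinMoment 0 k = 1 := by
  induction k with
  | zero =>
    simp [sinMoment, wallisWeight_zero, dividedPow_zero_left]
  | succ k ih =>
    have h := integral_sin_pow_by_parts k (p := fun _ => 1) (p' := fun _ => 0) (p'' := fun _ => 0)
      (fun x => hasDerivAt_const x 1) (fun x => hasDerivAt_const x 0) continuous_const rfl
    have hw := wallisWeight_succ k
    simp only [sinMoment, mul_zero, dividedPow_zero_left, mul_one, intervalIntegral.integral_zero,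
      add_zero, mul_add] at ih h ⊢
    set A := ∫ x in (0 : ℝ)..π / 2, sin x ^ (2 * k)
    set B := ∫ x in (0 : ℝ)..π / 2, sin x ^ (2 * k + 2)
    have h' : (2 * k + 1 : ℝ) * A = (2 * k + 2) * B := by
      have : (2 * k + 2 : ℝ) ≠ 0 := by positivity
      apply mul_left_cancel₀ this
      linear_combination h
    rw [← ih]
    have : (2 * k + 1 : ℝ) ≠ 0 := by positivity
    apply mul_left_cancel₀ this
    linear_combination 2 / π * B * hw - 2 / π * wallisWeight k * h'

lemma sinMoment_nonneg (b k : ℕ) : 0 ≤ sinMoment b k := by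
  have := wallisWeight_pos k
  have hI : 0 ≤ ∫ x in (0 : ℝ)..π / 2, sin x ^ (2 * k) * dividedPow (2 * b) (π - 2 * x) := by
    refine intervalIntegral.integral_nonneg (by positivity) fun x hx => ?_
    have := sin_nonneg_of_nonneg_of_le_pi hx.1 (by linarith [hx.2, pi_pos])
    exact mul_nonneg (pow_nonneg this _)
      (dividedPow_nonneg _ (by linarith [hx.2]))
  unfold sinMoment
  positivity

lemma sinMoment_succ_left (b k : ℕ) :
    sinMoment (b + 1) k = sinMoment (b + 1) (k + 1) + sinMoment b (k + 1) / ((k : ℝ) + 1) ^ 2 := by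
  have hd : ∀ x, HasDerivAt (fun t => -2 * dividedPow (2 * b + 1) (π - 2 * t))
      (4 * dividedPow (2 * b) (π - 2 * x)) x := fun x =>
    ((hasDerivAt_dividedPow_pi_sub (2 * b) x).const_mul (-2 : ℝ)).congr_deriv (by ring)
  have h := integral_sin_pow_by_parts k (fun x => hasDerivAt_dividedPow_pi_sub (2 * b + 1) x) hd
    (by have := continuous_dividedPow (2 * b); fun_prop)
    (by rw [mul_div_cancel₀ _ (two_ne_zero), sub_self, dividedPow_succ_zero, mul_zero])
  have hw := wallisWeight_succ k
  simp only [mul_left_comm (_ ^ (2 * k + 2)) (4 : ℝ), intervalIntegral.integral_const_mul] at h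
  simp only [sinMoment, mul_add, mul_one] at h ⊢
  set A := ∫ x in (0 : ℝ)..π / 2, sin x ^ (2 * k) * dividedPow (2 * b + 2) (π - 2 * x)
  set B := ∫ x in (0 : ℝ)..π / 2, sin x ^ (2 * k + 2) * dividedPow (2 * b + 2) (π - 2 * x)
  set C := ∫ x in (0 : ℝ)..π / 2, sin x ^ (2 * k + 2) * dividedPow (2 * b) (π - 2 * x)
  have h1 : (2 * k + 1 : ℝ) ≠ 0 := by positivity
  have h2 : (k + 1 : ℝ) ≠ 0 := by positivity
  have hw' : wallisWeight k = wallisWeight (k + 1) * (2 * k + 1) / (2 * k + 2) := by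
    rw [eq_div_iff (by positivity), hw]
  have hA : A = ((2 * k + 2) ^ 2 * B + 4 * C) / ((2 * k + 2) * (2 * k + 1)) := by
    rw [eq_div_iff (by positivity)]
    linear_combination h
  rw [hA, hw']
  have h3 : (2 * k + 2 : ℝ) ≠ 0 := by positivity
  field_simp
  ring

/-- The densities concentrate at `π / 2`, where `π - 2x` is at most a multiple of `cos x`, and the
mean of `cos x ^ 2` is `1 / (2k + 2)`. -/
lemma sinMoment_succ_le (b k : ℕ) :
    sinMoment (b + 1) k ≤ π ^ (2 * b + 2) / (2 * k + 2) := by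
  have hle : (∫ x in (0 : ℝ)..π / 2, sin x ^ (2 * k) * dividedPow (2 * (b + 1)) (π - 2 * x)) ≤
      ∫ x in (0 : ℝ)..π / 2, π ^ (2 * b + 2) * (sin x ^ (2 * k) - sin x ^ (2 * k + 2)) := by
    have := continuous_dividedPow (2 * (b + 1))
    refine intervalIntegral.integral_mono_on (by positivity)
      (Continuous.intervalIntegrable (by fun_prop) _ _)
      (Continuous.intervalIntegrable (by fun_prop) _ _) fun x hx => ?_
    have hs : 0 ≤ sin x := sin_nonneg_of_nonneg_of_le_pi hx.1 (by linarith [hx.2, pi_pos])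
    have hcos : (π - 2 * x) ≤ π * cos x := by
      have := mul_le_sin (x := π / 2 - x) (by linarith [hx.2]) (by linarith [hx.1])
      rw [sin_pi_div_two_sub, div_mul_eq_mul_div, div_le_iff₀ pi_pos] at this
      linarith
    have h0 : 0 ≤ π - 2 * x := by linarith [hx.2]
    have h1 : dividedPow (2 * (b + 1)) (π - 2 * x) ≤ (π - 2 * x) ^ (2 * b + 2) :=
      div_le_self (by positivity) (by exact_mod_cast Nat.succ_le_of_lt (Nat.factorial_pos _))
    have hc0 : 0 ≤ cos x := cos_nonneg_of_mem_Icc ⟨by linarith [hx.1, pi_pos], hx.2⟩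
    have h2 : (π - 2 * x) ^ (2 * b + 2) ≤ (π * cos x) ^ (2 * b + 2) := pow_le_pow_left₀ h0 hcos _
    have h3 : cos x ^ (2 * b + 2) ≤ cos x ^ 2 :=
      pow_le_pow_of_le_one hc0 (cos_le_one x) (by omega)
    have h4 : (π * cos x) ^ (2 * b + 2) ≤ π ^ (2 * b + 2) * cos x ^ 2 := by
      rw [mul_pow]; gcongr
    calc sin x ^ (2 * k) * dividedPow (2 * (b + 1)) (π - 2 * x)
        ≤ sin x ^ (2 * k) * (π ^ (2 * b + 2) * cos x ^ 2) := by
          gcongr; exact h1.trans (h2.trans h4)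
      _ = π ^ (2 * b + 2) * (sin x ^ (2 * k) - sin x ^ (2 * k + 2)) := by
          rw [cos_sq']; ring
  have h0 := sinMoment_zero_left k
  have h1 := sinMoment_zero_left (k + 1)
  have hw := wallisWeight_succ k
  have hp := wallisWeight_pos k
  rw [intervalIntegral.integral_const_mul, intervalIntegral.integral_sub
    (Continuous.intervalIntegrable (by fun_prop) _ _)
    (Continuous.intervalIntegrable (by fun_prop) _ _)] at hle
  simp only [sinMoment, mul_zero, dividedPow_zero_left, mul_one, mul_add] at h0 h1
  unfold sinMoment
  refine (mul_le_mul_of_nonneg_left hle (by positivity)).trans (le_of_eq ?_)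
  set A := ∫ x in (0 : ℝ)..π / 2, sin x ^ (2 * k)
  set B := ∫ x in (0 : ℝ)..π / 2, sin x ^ (2 * k + 2)
  rw [eq_div_iff (by positivity)]
  linear_combination (2 * k + 2) * π ^ (2 * b + 2) * h0 - (2 * k + 1) * π ^ (2 * b + 2) * h1 +
    2 / π * B * π ^ (2 * b + 2) * hw

lemma tendsto_sinMoment_succ (b : ℕ) : Tendsto (sinMoment (b + 1)) atTop (𝓝 0) := by
  refine squeeze_zero (fun k => sinMoment_nonneg _ k) (fun k => sinMoment_succ_le b k) ?_
  refine Tendsto.const_div_atTop (tendsto_atTop_add_const_right _ _ ?_) _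
  exact tendsto_natCast_atTop_atTop.const_mul_atTop (by norm_num)

/-- The recursion for `sinMoment` telescopes. -/
lemma hasSum_sinMoment_succ (b m : ℕ) :
    HasSum (fun j : ℕ => sinMoment b (m + j + 1) / ((m + j + 1 : ℕ) : ℝ) ^ 2)
      (sinMoment (b + 1) m) := by
  rw [hasSum_iff_tendsto_nat_of_nonneg
    fun j => div_nonneg (sinMoment_nonneg b _) (by positivity)]
  have : ∀ n, ∑ j ∈ Finset.range n, sinMoment b (m + j + 1) / ((m + j + 1 : ℕ) : ℝ) ^ 2 =
      sinMoment (b + 1) m - sinMoment (b + 1) (m + n) := by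
    intro n
    induction n with
    | zero => simp
    | succ n ih =>
      rw [Finset.sum_range_succ, ih, sinMoment_succ_left b (m + n), add_assoc m n 1]
      push_cast
      ring
  simp_rw [this]
  simpa using (((tendsto_sinMoment_succ b).comp (tendsto_add_atTop_nat m)).const_sub
    (sinMoment (b + 1) m)).congr fun n => by simp [add_comm]

/-- The moment with an odd power of `π - 2x`, obtained by one integration by parts. -/
lemma integral_sin_pow_mul_cos_mul_dividedPow (b k : ℕ) :
    2 / π * (wallisWeight (k + 1) * ∫ x in (0 : ℝ)..π / 2,
      sin x ^ (2 * k + 1) * cos x * dividedPow (2 * b + 1) (π - 2 * x)) =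
      sinMoment b (k + 1) / (k + 1) := by
  have hd : ∀ x, HasDerivAt (fun t => sin t ^ (2 * k + 2) * dividedPow (2 * b + 1) (π - 2 * t))
      ((2 * k + 2) * (sin x ^ (2 * k + 1) * cos x * dividedPow (2 * b + 1) (π - 2 * x)) -
        2 * (sin x ^ (2 * k + 2) * dividedPow (2 * b) (π - 2 * x))) x := by
    intro x
    refine ((hasDerivAt_sin_pow (2 * k + 1) x).mul
      (hasDerivAt_dividedPow_pi_sub (2 * b) x)).congr_deriv ?_
    push_cast
    ring
  have c1 := continuous_dividedPow (2 * b + 1)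
  have c2 := continuous_dividedPow (2 * b)
  have h := intervalIntegral.integral_eq_sub_of_hasDerivAt (a := 0) (b := π / 2)
    (fun x _ => hd x) (Continuous.intervalIntegrable (by fun_prop) _ _)
  rw [intervalIntegral.integral_sub (Continuous.intervalIntegrable (by fun_prop) _ _)
    (Continuous.intervalIntegrable (by fun_prop) _ _),
    intervalIntegral.integral_const_mul, intervalIntegral.integral_const_mul,
    mul_div_cancel₀ _ (two_ne_zero), sub_self, dividedPow_succ_zero] at h
  simp at h
  rw [sinMoment, eq_div_iff (by positivity), mul_add 2 k 1]
  linear_combination (1 / π * wallisWeight (k + 1)) * h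

/-! ### Expansion of even powers of an angle in powers of its sine -/

/-- The finite multiple sum `∑ 1 / (j₁ ⋯ j_a) ^ 2` over `1 ≤ j₁ < ⋯ < j_a ≤ k`. -/
noncomputable def headSum : ℕ → ℕ → ℝ
  | 0, _ => 1
  | a + 1, k => ∑ j ∈ Finset.range k, headSum a j / ((j : ℝ) + 1) ^ 2

lemma headSum_nonneg (a k : ℕ) : 0 ≤ headSum a k := by
  induction a generalizing k with
  | zero => simp [headSum]
  | succ a ih => exact Finset.sum_nonneg fun j _ => div_nonneg (ih j) (by positivity)

lemma headSum_le (a k : ℕ) : headSum a k ≤ (k : ℝ) ^ a := by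
  induction a generalizing k with
  | zero => simp [headSum]
  | succ a ih =>
    have : ∀ j ∈ Finset.range k, headSum a j / ((j : ℝ) + 1) ^ 2 ≤ (k : ℝ) ^ a := fun j hj => by
      have hjk : (j : ℝ) ≤ k := by exact_mod_cast (Finset.mem_range.1 hj).le
      have h1 : (1 : ℝ) ≤ ((j : ℝ) + 1) ^ 2 := one_le_pow₀ (by linarith [j.cast_nonneg (α := ℝ)])
      exact (div_le_self (headSum_nonneg a j) h1).trans
        ((ih j).trans (pow_le_pow_left₀ j.cast_nonneg hjk a))
    refine (Finset.sum_le_card_nsmul _ _ _ this).trans (le_of_eq ?_)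
    simp [pow_succ, mul_comm]

lemma monotoneOn_of_second_deriv_nonneg {f f' f'' : ℝ → ℝ} {c : ℝ}
    (hf : ∀ x, HasDerivAt f (f' x) x) (hf' : ∀ x, HasDerivAt f' (f'' x) x) (h0 : f' 0 = 0)
    (h : ∀ x ∈ Set.Icc 0 c, 0 ≤ f'' x) : MonotoneOn f (Set.Icc 0 c) := by
  have key : ∀ {g g' : ℝ → ℝ}, (∀ x, HasDerivAt g (g' x) x) → (∀ x ∈ Set.Icc 0 c, 0 ≤ g' x) →
      MonotoneOn g (Set.Icc 0 c) := fun {g g'} hg hg' => by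
    refine monotoneOn_of_deriv_nonneg (convex_Icc 0 c)
      (fun x _ => (hg x).continuousAt.continuousWithinAt)
      (fun x _ => (hg x).differentiableAt.differentiableWithinAt) fun x hx => ?_
    rw [(hg x).deriv]
    exact hg' x (interior_subset hx)
  refine key hf fun x hx => ?_
  rw [← h0]
  exact key hf' h ⟨le_rfl, hx.1.trans hx.2⟩ hx hx.1

/-- The `k`-th term of the expansion of `(2x) ^ (2a + 2) / (2a + 2)!` in powers of `sin x ^ 2`. -/
noncomputable def sinTerm (a k : ℕ) (x : ℝ) : ℝ :=
  headSum a k * (wallisWeight (k + 1) / ((k : ℝ) + 1) ^ 2) * sin x ^ (2 * k + 2)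

/-- The remainder of order `K` of the expansion of `(2x) ^ (2a + 2) / (2a + 2)!`. -/
noncomputable def sinRemainder (a K : ℕ) (x : ℝ) : ℝ :=
  dividedPow (2 * a + 2) (2 * x) - ∑ k ∈ Finset.range K, sinTerm a k x

lemma sinTerm_nonneg (a k : ℕ) (x : ℝ) : 0 ≤ sinTerm a k x := by
  have := headSum_nonneg a k
  have := wallisWeight_pos (k + 1)
  have : 0 ≤ sin x ^ (2 * k + 2) := Even.pow_nonneg ⟨k + 1, by ring⟩ _
  unfold sinTerm
  positivity

lemma sinRemainder_apply_zero (a K : ℕ) : sinRemainder a K 0 = 0 := by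
  simp [sinRemainder, sinTerm, dividedPow_succ_zero]

/-- The coefficients are chosen so that the second derivative of each term is a difference of two
consecutive weighted powers of the sine. -/
lemma exists_hasDerivAt_sinRemainder (a K : ℕ) : ∃ f' : ℝ → ℝ, f' 0 = 0 ∧
    (∀ x, HasDerivAt (sinRemainder a K) (f' x) x) ∧
    ∀ x, HasDerivAt f' (4 * (dividedPow (2 * a) (2 * x) - ∑ k ∈ Finset.range K, headSum a k *
      (wallisWeight k * sin x ^ (2 * k) - wallisWeight (k + 1) * sin x ^ (2 * k + 2)))) x := by
  refine ⟨fun x => 2 * dividedPow (2 * a + 1) (2 * x) - ∑ k ∈ Finset.range K,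
    headSum a k * (wallisWeight (k + 1) / ((k : ℝ) + 1) ^ 2) *
      ((2 * k + 2) * sin x ^ (2 * k + 1) * cos x), ?_, fun x => ?_, fun x => ?_⟩
  · simp [dividedPow_succ_zero]
  · refine (hasDerivAt_dividedPow_two_mul (2 * a + 1) x).sub
      (HasDerivAt.fun_sum fun k _ => HasDerivAt.const_mul _ ?_)
    exact (hasDerivAt_sin_pow (2 * k + 1) x).congr_deriv (by push_cast; ring)
  · refine (((hasDerivAt_dividedPow_two_mul (2 * a) x).const_mul (2 : ℝ)).sub
      (HasDerivAt.fun_sum fun k _ =>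
        HasDerivAt.const_mul _ (hasDerivAt_sin_pow_mul_cos k x))).congr_deriv ?_
    rw [mul_sub, Finset.mul_sum]
    congr 1
    · ring
    · refine Finset.sum_congr rfl fun k _ => ?_
      have h1 : (k + 1 : ℝ) ≠ 0 := by positivity
      have hw : wallisWeight k = wallisWeight (k + 1) * (2 * k + 1) / (2 * k + 2) := by
        rw [eq_div_iff (by positivity), wallisWeight_succ]
      have h3 : (2 * k + 2 : ℝ) ≠ 0 := by positivity
      rw [hw]
      field_simp
      ring

/-- Summation by parts against `headSum 0 = 1`. -/
lemma sum_headSum_zero (u : ℕ → ℝ) (K : ℕ) :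
    ∑ k ∈ Finset.range K, headSum 0 k * (u k - u (k + 1)) = u 0 - u K := by
  simp only [headSum, one_mul]
  exact Finset.sum_range_sub' u K

/-- Summation by parts, which lowers the depth `a + 1` of `headSum` to `a`. -/
lemma sum_headSum_succ (a : ℕ) (u : ℕ → ℝ) (K : ℕ) :
    ∑ k ∈ Finset.range (K + 1), headSum (a + 1) k * (u k - u (k + 1)) =
      (∑ k ∈ Finset.range K, headSum a k / ((k : ℝ) + 1) ^ 2 * u (k + 1)) -
        headSum (a + 1) K * u (K + 1) := by
  induction K with
  | zero => simp [headSum]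
  | succ K ih =>
    have h : headSum (a + 1) (K + 1) = headSum (a + 1) K + headSum a K / ((K : ℝ) + 1) ^ 2 :=
      Finset.sum_range_succ _ _
    rw [Finset.sum_range_succ, ih, Finset.sum_range_succ, h]
    ring

lemma tendsto_headSum_mul_sin_pow (a : ℕ) {x : ℝ} (hx : x ∈ Set.Ico 0 (π / 2)) :
    Tendsto (fun K => headSum a K * (wallisWeight (K + 1) * sin x ^ (2 * K + 2))) atTop (𝓝 0) := by
  have hs0 : 0 ≤ sin x := sin_nonneg_of_nonneg_of_le_pi hx.1 (by linarith [hx.2, pi_pos])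
  have hs1 : sin x < 1 := by
    rw [← sin_pi_div_two]
    exact sin_lt_sin_of_lt_of_le_pi_div_two (by linarith [hx.1, pi_pos]) le_rfl hx.2
  have hr : |sin x ^ 2| < 1 := by
    rw [abs_of_nonneg (by positivity)]
    exact pow_lt_one₀ hs0 hs1 two_ne_zero
  have h := ((tendsto_add_atTop_iff_nat 1).2
    (tendsto_pow_const_mul_const_pow_of_abs_lt_one (a + 1) hr)).const_mul 3
  rw [mul_zero] at h
  refine squeeze_zero (fun K => ?_) (fun K => ?_) h
  · have := headSum_nonneg a K
    have := wallisWeight_pos (K + 1)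
    positivity
  · have h1 : headSum a K ≤ ((K + 1 : ℕ) : ℝ) ^ a :=
      (headSum_le a K).trans (pow_le_pow_left₀ K.cast_nonneg (by push_cast; linarith) a)
    have h2 : wallisWeight (K + 1) ≤ 3 * ((K + 1 : ℕ) : ℝ) := by
      refine (wallisWeight_le (K + 1)).trans ?_
      push_cast
      linarith [K.cast_nonneg (α := ℝ)]
    have := wallisWeight_pos (K + 1)
    calc headSum a K * (wallisWeight (K + 1) * sin x ^ (2 * K + 2))
        ≤ ((K + 1 : ℕ) : ℝ) ^ a * (3 * ((K + 1 : ℕ) : ℝ) * sin x ^ (2 * K + 2)) := by gcongr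
      _ = 3 * (((K + 1 : ℕ) : ℝ) ^ (a + 1) * (sin x ^ 2) ^ (K + 1)) := by
        rw [← pow_mul]; ring

/-- A function that vanishes to second order at `0` is controlled by its second derivative. -/
lemma le_of_second_deriv_le {f f' f'' : ℝ → ℝ} {c M : ℝ} (hc : 0 ≤ c)
    (hf : ∀ x, HasDerivAt f (f' x) x) (hf' : ∀ x, HasDerivAt f' (f'' x) x) (hf0 : f 0 = 0)
    (h0 : f' 0 = 0) (h : ∀ x ∈ Set.Icc 0 c, f'' x ≤ M) : f c ≤ M / 2 * c ^ 2 := by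
  have h1 : ∀ x, HasDerivAt (fun t => M / 2 * t ^ 2 - f t) (M * x - f' x) x := fun x =>
    (((hasDerivAt_pow 2 x).const_mul (M / 2)).sub (hf x)).congr_deriv (by simp; ring)
  have h2 : ∀ x, HasDerivAt (fun t => M * t - f' t) (M - f'' x) x := fun x =>
    (((hasDerivAt_id x).const_mul M).sub (hf' x)).congr_deriv (by simp)
  have := monotoneOn_of_second_deriv_nonneg h1 h2 (by simp [h0])
    (fun x hx => sub_nonneg.2 (h x hx)) ⟨le_rfl, hc⟩ ⟨hc, le_rfl⟩ hc
  simp [hf0] at this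
  linarith

lemma sin_pow_mono {x y : ℝ} (n : ℕ) (hx : 0 ≤ x) (hxy : x ≤ y) (hy : y ≤ π / 2) :
    sin x ^ n ≤ sin y ^ n :=
  pow_le_pow_left₀ (sin_nonneg_of_nonneg_of_le_pi hx (by linarith [pi_pos]))
    (sin_le_sin_of_le_of_le_pi_div_two (by linarith [pi_pos]) hy hxy) n

lemma sinRemainder_nonneg_of_monotoneOn {a K : ℕ}
    (h : MonotoneOn (sinRemainder a K) (Set.Icc 0 (π / 2)))
    {x : ℝ} (hx : x ∈ Set.Icc 0 (π / 2)) : 0 ≤ sinRemainder a K x := by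
  rw [← sinRemainder_apply_zero a K]
  exact h ⟨le_rfl, by positivity⟩ hx hx.1

/-- The remainders increase on `[0, π / 2]` and tend to `0` on `[0, π / 2)`. Each second derivative
is four times the remainder for `a - 1` (zero for `a = 0`) plus a nonnegative multiple of a power of
the sine, so that induction on `a` bounds it at the right end of every interval `[0, x]`. -/
lemma sinRemainder_spec (a : ℕ) :
    (∀ K, MonotoneOn (sinRemainder a K) (Set.Icc 0 (π / 2))) ∧
      ∀ x ∈ Set.Ico 0 (π / 2), Tendsto (fun K => sinRemainder a K x) atTop (𝓝 0) := by
  induction a with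
  | zero =>
    have hd : ∀ (K : ℕ) (x : ℝ), 4 * (dividedPow (2 * 0) (2 * x) -
        ∑ k ∈ Finset.range K, headSum 0 k *
        (wallisWeight k * sin x ^ (2 * k) - wallisWeight (k + 1) * sin x ^ (2 * k + 2))) =
        4 * (wallisWeight K * sin x ^ (2 * K)) := fun K x => by
      have := sum_headSum_zero (fun k => wallisWeight k * sin x ^ (2 * k)) K
      simp only [mul_add, mul_one] at this
      rw [this]
      simp [dividedPow_zero_left, wallisWeight_zero]
    have hmono : ∀ K, MonotoneOn (sinRemainder 0 K) (Set.Icc 0 (π / 2)) := fun K => by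
      obtain ⟨f', h0, h1, h2⟩ := exists_hasDerivAt_sinRemainder 0 K
      simp only [hd] at h2
      refine monotoneOn_of_second_deriv_nonneg h1 h2 h0 fun x hx => ?_
      have := wallisWeight_pos K
      have := sin_nonneg_of_nonneg_of_le_pi hx.1 (by linarith [hx.2, pi_pos])
      positivity
    refine ⟨hmono, fun x hx => ?_⟩
    rw [← tendsto_add_atTop_iff_nat 1]
    have ht := (((tendsto_headSum_mul_sin_pow 0 hx).const_mul 4).div_const 2).mul_const (x ^ 2)
    simp only [mul_zero, zero_div, zero_mul] at ht
    refine squeeze_zero (fun K => sinRemainder_nonneg_of_monotoneOn (hmono _) ⟨hx.1, hx.2.le⟩)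
      (fun K => ?_) ht
    obtain ⟨f', h0, h1, h2⟩ := exists_hasDerivAt_sinRemainder 0 (K + 1)
    simp only [hd] at h2
    refine le_of_second_deriv_le hx.1 h1 h2 (sinRemainder_apply_zero _ _) h0 fun y hy => ?_
    have := wallisWeight_pos (K + 1)
    have := sin_pow_mono (2 * K + 2) hy.1 hy.2 hx.2.le
    simp only [headSum, one_mul, mul_add, mul_one]
    gcongr
  | succ a ih =>
    obtain ⟨ihm, iht⟩ := ih
    have hd : ∀ (K : ℕ) (x : ℝ), 4 * (dividedPow (2 * (a + 1)) (2 * x) -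
        ∑ k ∈ Finset.range (K + 1), headSum (a + 1) k *
        (wallisWeight k * sin x ^ (2 * k) - wallisWeight (k + 1) * sin x ^ (2 * k + 2))) =
        4 * (sinRemainder a K x +
          headSum (a + 1) K * (wallisWeight (K + 1) * sin x ^ (2 * K + 2))) := fun K x => by
      have := sum_headSum_succ a (fun k => wallisWeight k * sin x ^ (2 * k)) K
      simp only [mul_add, mul_one] at this
      rw [this, sinRemainder]
      have : ∀ k, sinTerm a k x =
          headSum a k / ((k : ℝ) + 1) ^ 2 * (wallisWeight (k + 1) * sin x ^ (2 * k + 2)) :=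
        fun k => by rw [sinTerm]; ring
      simp only [this, mul_add, mul_one]
      ring
    have hmono : ∀ K, MonotoneOn (sinRemainder (a + 1) (K + 1)) (Set.Icc 0 (π / 2)) := fun K => by
      obtain ⟨f', h0, h1, h2⟩ := exists_hasDerivAt_sinRemainder (a + 1) (K + 1)
      simp only [hd] at h2
      refine monotoneOn_of_second_deriv_nonneg h1 h2 h0 fun x hx => ?_
      have := wallisWeight_pos (K + 1)
      have := headSum_nonneg (a + 1) K
      have := sin_nonneg_of_nonneg_of_le_pi hx.1 (by linarith [hx.2, pi_pos])
      have := sinRemainder_nonneg_of_monotoneOn (ihm K) hx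
      positivity
    refine ⟨fun K => ?_, fun x hx => ?_⟩
    · cases K with
      | zero =>
        -- The first term vanishes, so the remainders of order `0` and `1` coincide.
        have : sinRemainder (a + 1) 0 = sinRemainder (a + 1) 1 := by
          ext x
          simp [sinRemainder, sinTerm, headSum]
        rw [this]
        exact hmono 0
      | succ K => exact hmono K
    rw [← tendsto_add_atTop_iff_nat 1]
    have ht := ((((iht x hx).add (tendsto_headSum_mul_sin_pow (a + 1) hx)).const_mul 4).div_const
      2).mul_const (x ^ 2)
    simp only [add_zero, mul_zero, zero_div, zero_mul] at ht
    refine squeeze_zero (fun K => sinRemainder_nonneg_of_monotoneOn (hmono K) ⟨hx.1, hx.2.le⟩)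
      (fun K => ?_) ht
    obtain ⟨f', h0, h1, h2⟩ := exists_hasDerivAt_sinRemainder (a + 1) (K + 1)
    simp only [hd] at h2
    refine le_of_second_deriv_le hx.1 h1 h2 (sinRemainder_apply_zero _ _) h0 fun y hy => ?_
    have := wallisWeight_pos (K + 1)
    have := headSum_nonneg (a + 1) K
    have := sin_pow_mono (2 * K + 2) hy.1 hy.2 hx.2.le
    have := ihm K ⟨hy.1, hy.2.trans hx.2.le⟩ ⟨hx.1, hx.2.le⟩ hy.2
    gcongr

lemma sum_sinTerm_le (a K : ℕ) {x : ℝ} (hx : x ∈ Set.Icc 0 (π / 2)) :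
    ∑ k ∈ Finset.range K, sinTerm a k x ≤ dividedPow (2 * a + 2) (2 * x) :=
  sub_nonneg.1 (sinRemainder_nonneg_of_monotoneOn ((sinRemainder_spec a).1 K) hx)

lemma tendsto_sum_sinTerm (a : ℕ) {x : ℝ} (hx : x ∈ Set.Ico 0 (π / 2)) :
    Tendsto (fun K => ∑ k ∈ Finset.range K, sinTerm a k x) atTop
      (𝓝 (dividedPow (2 * a + 2) (2 * x))) := by
  simpa [sinRemainder] using
    ((sinRemainder_spec a).2 x hx).const_sub (dividedPow (2 * a + 2) (2 * x))

/-! ### The integral representation of the double series -/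

/-- The integral representing `ζ({2}^a, 3, {2}^b)`. -/
noncomputable def cotIntegral (a b : ℕ) : ℝ :=
  2 / π * ∫ x in (0 : ℝ)..π / 2,
    dividedPow (2 * a + 2) (2 * x) * (cot x * dividedPow (2 * b + 1) (π - 2 * x))

lemma dividedPow_mul_cot_le (a : ℕ) {x : ℝ} (hx : x ∈ Set.Ioo 0 (π / 2)) :
    dividedPow (2 * a + 2) (2 * x) * cot x ≤ 2 * π ^ (2 * a + 1) := by
  have hc : 0 < cos x := cos_pos_of_mem_Ioo ⟨by linarith [hx.1, pi_pos], hx.2⟩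
  have hs : 0 < sin x := sin_pos_of_pos_of_lt_pi hx.1 (by linarith [hx.2, pi_pos])
  have h1 : x * cot x ≤ 1 := by
    have := lt_tan hx.1 hx.2
    rw [tan_eq_sin_div_cos, lt_div_iff₀ hc] at this
    rw [cot_eq_cos_div_sin, mul_div_assoc', div_le_one hs]
    exact this.le
  have h0 : 0 ≤ cot x := by rw [cot_eq_cos_div_sin]; positivity
  have hx0 : 0 ≤ 2 * x := by linarith [hx.1]
  have h2 : dividedPow (2 * a + 2) (2 * x) ≤ (2 * x) ^ (2 * a + 2) :=
    div_le_self (by positivity) (by exact_mod_cast Nat.succ_le_of_lt (Nat.factorial_pos _))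
  have h3 : (2 * x) ^ (2 * a + 1) ≤ π ^ (2 * a + 1) := pow_le_pow_left₀ hx0 (by linarith [hx.2]) _
  calc dividedPow (2 * a + 2) (2 * x) * cot x ≤ (2 * x) ^ (2 * a + 2) * cot x := by gcongr
    _ = (2 * x) ^ (2 * a + 1) * (2 * (x * cot x)) := by ring
    _ ≤ π ^ (2 * a + 1) * (2 * 1) := by
      have := hx.1
      gcongr
    _ = _ := by ring

/-- The expansion of `(2x) ^ (2a + 2)` may be integrated term by term: the partial sums increase and
stay below their limit, which has a bounded product with the cotangent. -/
lemma hasSum_headSum_mul_sinMoment (a b : ℕ) :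
    HasSum (fun k : ℕ => headSum a k * (sinMoment b (k + 1) / ((k : ℝ) + 1) ^ 3))
      (cotIntegral a b) := by
  have hnn : ∀ k, 0 ≤ headSum a k * (sinMoment b (k + 1) / ((k : ℝ) + 1) ^ 3) := fun k =>
    mul_nonneg (headSum_nonneg a k) (div_nonneg (sinMoment_nonneg b _) (by positivity))
  rw [hasSum_iff_tendsto_nat_of_nonneg hnn]
  have c1 := continuous_dividedPow (2 * b + 1)
  have hterm : ∀ k, headSum a k * (sinMoment b (k + 1) / ((k : ℝ) + 1) ^ 3) =
      2 / π * ∫ x in (0 : ℝ)..π / 2, headSum a k * (wallisWeight (k + 1) / ((k : ℝ) + 1) ^ 2) *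
        (sin x ^ (2 * k + 1) * cos x * dividedPow (2 * b + 1) (π - 2 * x)) := fun k => by
    have h := integral_sin_pow_mul_cos_mul_dividedPow b k
    have h1 : (k + 1 : ℝ) ≠ 0 := by positivity
    rw [intervalIntegral.integral_const_mul]
    calc _ = headSum a k * (sinMoment b (k + 1) / (k + 1)) / (k + 1) ^ 2 := by field_simp
      _ = _ := by rw [← h]; ring
  have hsum : ∀ K, ∑ k ∈ Finset.range K, headSum a k * (sinMoment b (k + 1) / ((k : ℝ) + 1) ^ 3) =
      2 / π * ∫ x in (0 : ℝ)..π / 2, ∑ k ∈ Finset.range K,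
        headSum a k * (wallisWeight (k + 1) / ((k : ℝ) + 1) ^ 2) *
        (sin x ^ (2 * k + 1) * cos x * dividedPow (2 * b + 1) (π - 2 * x)) := fun K => by
    rw [intervalIntegral.integral_finsetSum
      fun k _ => Continuous.intervalIntegrable (by fun_prop) _ _, Finset.mul_sum]
    exact Finset.sum_congr rfl fun k _ => hterm k
  simp only [hsum]
  refine Tendsto.const_mul _ ?_
  have hrw : ∀ (K : ℕ), ∀ x ∈ Set.Ioo 0 (π / 2), ∑ k ∈ Finset.range K,
        headSum a k * (wallisWeight (k + 1) / ((k : ℝ) + 1) ^ 2) *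
        (sin x ^ (2 * k + 1) * cos x * dividedPow (2 * b + 1) (π - 2 * x)) =
      (∑ k ∈ Finset.range K, sinTerm a k x) * (cot x * dividedPow (2 * b + 1) (π - 2 * x)) := by
    intro K x hx
    have hs : sin x ≠ 0 := (sin_pos_of_pos_of_lt_pi hx.1 (by linarith [hx.2, pi_pos])).ne'
    rw [Finset.sum_mul]
    refine Finset.sum_congr rfl fun k _ => ?_
    rw [sinTerm, cot_eq_cos_div_sin, pow_succ (sin x) (2 * k + 1)]
    field_simp
  have hae : ∀ᵐ x : ℝ, x ≠ π / 2 := by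
    simp [MeasureTheory.ae_iff, MeasureTheory.measure_singleton]
  have hIoo : ∀ x ∈ Set.uIoc 0 (π / 2), x ≠ π / 2 → x ∈ Set.Ioo 0 (π / 2) := fun x hx hne => by
    rw [Set.uIoc_of_le (by positivity)] at hx
    exact ⟨hx.1, lt_of_le_of_ne hx.2 hne⟩
  refine intervalIntegral.tendsto_integral_filter_of_dominated_convergence
    (fun _ => 2 * π ^ (2 * a + 1) * π ^ (2 * b + 1)) ?_ ?_ (by simp) ?_
  · exact Eventually.of_forall fun K =>
      (Continuous.aestronglyMeasurable (by fun_prop))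
  · refine Eventually.of_forall fun K => ?_
    filter_upwards [hae] with x hne hx
    have hx' := hIoo x hx hne
    have hs : 0 < sin x := sin_pos_of_pos_of_lt_pi hx'.1 (by linarith [hx'.2, pi_pos])
    have hc : 0 < cos x := cos_pos_of_mem_Ioo ⟨by linarith [hx'.1, pi_pos], hx'.2⟩
    have hcot : 0 ≤ cot x := by rw [cot_eq_cos_div_sin]; positivity
    have hp0 : 0 ≤ π - 2 * x := by linarith [hx'.2]
    have hq := dividedPow_nonneg (2 * b + 1) hp0
    have hq' : dividedPow (2 * b + 1) (π - 2 * x) ≤ π ^ (2 * b + 1) :=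
      (div_le_self (by positivity) (by exact_mod_cast Nat.succ_le_of_lt (Nat.factorial_pos _))).trans
        (pow_le_pow_left₀ hp0 (by linarith [hx'.1]) _)
    have h0 : 0 ≤ ∑ k ∈ Finset.range K, sinTerm a k x :=
      Finset.sum_nonneg fun k _ => sinTerm_nonneg a k x
    rw [hrw K x hx', norm_of_nonneg (by positivity), ← mul_assoc]
    refine mul_le_mul (le_trans ?_ (dividedPow_mul_cot_le a hx')) hq' hq (by positivity)
    exact mul_le_mul_of_nonneg_right (sum_sinTerm_le a K ⟨hx'.1.le, hx'.2.le⟩) hcot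
  · filter_upwards [hae] with x hne hx
    have hx' := hIoo x hx hne
    simp only [hrw _ x hx']
    exact (tendsto_sum_sinTerm a ⟨hx'.1.le, hx'.2⟩).mul_const _

/-! ### The generating function of the even zeta values -/

/-- The real number `ζ(2n)`, with `ζ(0) = -1/2`. -/
noncomputable def evenZeta (n : ℕ) : ℝ := (riemannZeta (2 * (n : ℂ))).re

lemma evenZeta_zero : evenZeta 0 = -1 / 2 := by
  norm_num [evenZeta, riemannZeta_zero]

lemma riemannZeta_two_mul_succ (n : ℕ) : riemannZeta (2 * ((n + 1 : ℕ) : ℂ)) =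
    ((∑' k : ℕ, 1 / ((k : ℝ) + 1) ^ (2 * (n + 1)) : ℝ) : ℂ) := by
  have h := zeta_eq_tsum_one_div_nat_add_one_cpow (s := ((2 * (n + 1) : ℕ) : ℂ))
    (by rw [Complex.natCast_re]; exact_mod_cast (by omega : 1 < 2 * (n + 1)))
  simp only [Complex.cpow_natCast] at h
  push_cast at h ⊢
  exact h

lemma ofReal_evenZeta (n : ℕ) : (evenZeta n : ℂ) = riemannZeta (2 * (n : ℂ)) := by
  cases n with
  | zero => rw [evenZeta_zero]; simp [riemannZeta_zero]
  | succ n => rw [evenZeta, riemannZeta_two_mul_succ, Complex.ofReal_re]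

lemma evenZeta_succ (n : ℕ) : evenZeta (n + 1) = ∑' k : ℕ, 1 / ((k : ℝ) + 1) ^ (2 * (n + 1)) := by
  rw [evenZeta, riemannZeta_two_mul_succ, Complex.ofReal_re]

/-- The partial fraction expansion of the cotangent, with the terms written as the sums of geometric
series in `(x / (k + 1)) ^ 2`. -/
lemma hasSum_div_one_sub_sq {x : ℝ} (hx : x ∈ Set.Ioo 0 1) :
    HasSum (fun k : ℕ => (x / (k + 1)) ^ 2 / (1 - (x / (k + 1)) ^ 2))
      (1 / 2 - π * x / 2 * cot (π * x)) := by
  have hz : (x : ℂ) ∈ Complex.integerComplement := by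
    rw [Complex.mem_integerComplement_iff]
    rintro ⟨n, hn⟩
    have hn' : (n : ℝ) = x := by exact_mod_cast hn
    have h1 : (0 : ℝ) < n := hn' ▸ hx.1
    have h2 : (n : ℝ) < 1 := hn' ▸ hx.2
    norm_cast at h1 h2
    omega
  have h := (summable_cotTerm hz).hasSum
  rw [show (∑' n : ℕ, cotTerm (x : ℂ) n) = π * Complex.cot (π * x) - 1 / x from
    (cot_series_rep' hz).symm] at h
  have hx0 : x ≠ 0 := hx.1.ne'
  have hxC : (x : ℂ) ≠ 0 := by exact_mod_cast hx0
  have hterm : ∀ k : ℕ, (((x / (k + 1)) ^ 2 / (1 - (x / (k + 1)) ^ 2) : ℝ) : ℂ) =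
      -(x : ℂ) / 2 * cotTerm (x : ℂ) k := fun k => by
    have hk : x < k + 1 := by linarith [hx.2, k.cast_nonneg (α := ℝ)]
    have h1 : (k + 1 : ℝ) ≠ 0 := by positivity
    have h2 : (1 - (x / (k + 1)) ^ 2 : ℝ) ≠ 0 := by
      have : x / (k + 1) < 1 := by rw [div_lt_one (by positivity)]; exact hk
      have h0 : 0 ≤ x / (k + 1) := by have := hx.1; positivity
      nlinarith
    have h3 : x + (k + 1) ≠ 0 := by have := hx.1; positivity
    have h4 : x - (k + 1) ≠ 0 := by linarith
    have : (x / (k + 1)) ^ 2 / (1 - (x / (k + 1)) ^ 2) =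
        -x / 2 * (2 * x * (1 / ((x + (k + 1)) * (x - (k + 1))))) := by
      rw [div_eq_iff h2]
      field_simp
      ring
    rw [cotTerm_identity hz, this]
    push_cast
    rfl
  have hval : ((1 / 2 - π * x / 2 * cot (π * x) : ℝ) : ℂ) =
      -(x : ℂ) / 2 * (π * Complex.cot (π * x) - 1 / x) := by
    push_cast
    field_simp
    ring
  rw [← Complex.hasSum_ofReal, hval]
  simp only [hterm]
  exact h.mul_left _

/-- The generating function `∑ ζ(2n) x ^ (2n) = -(πx / 2) cot (πx)`. -/
lemma hasSum_evenZeta_mul_pow {x : ℝ} (hx : x ∈ Set.Ioo 0 1) :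
    HasSum (fun n : ℕ => evenZeta n * x ^ (2 * n)) (-(π * x / 2 * cot (π * x))) := by
  have hmain := hasSum_div_one_sub_sq hx
  have hy0 : ∀ k : ℕ, 0 ≤ (x / (k + 1)) ^ 2 := fun k => by positivity
  have hy1 : ∀ k : ℕ, (x / (k + 1)) ^ 2 < 1 := fun k => by
    have h0 : 0 ≤ x / (k + 1) := by have := hx.1; positivity
    have : x / (k + 1) < 1 := by
      rw [div_lt_one (by positivity)]
      linarith [hx.2, k.cast_nonneg (α := ℝ)]
    exact pow_lt_one₀ h0 this two_ne_zero
  have hgeom : ∀ k : ℕ, HasSum (fun n : ℕ => ((x / (k + 1)) ^ 2) ^ (n + 1))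
      ((x / (k + 1)) ^ 2 / (1 - (x / (k + 1)) ^ 2)) := fun k => by
    simp only [pow_succ' ((x / ((k : ℝ) + 1)) ^ 2)]
    rw [div_eq_mul_inv _ (1 - _)]
    exact (hasSum_geometric_of_lt_one (hy0 k) (hy1 k)).mul_left _
  have hs : Summable (fun p : ℕ × ℕ => ((x / (p.1 + 1)) ^ 2) ^ (p.2 + 1)) := by
    rw [summable_prod_of_nonneg fun p => pow_nonneg (hy0 p.1) _]
    refine ⟨fun k => (hgeom k).summable, ?_⟩
    simp only [fun k => (hgeom k).tsum_eq]
    exact hmain.summable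
  have hval := hs.hasSum.prod_fiberwise fun k => hgeom k
  have hswap := (Equiv.prodComm ℕ ℕ).hasSum_iff.2 hs.hasSum
  rw [hval.unique hmain] at hswap
  have hn : ∀ n : ℕ, HasSum (fun k : ℕ => ((x / (k + 1)) ^ 2) ^ (n + 1))
      (evenZeta (n + 1) * x ^ (2 * (n + 1))) := fun n => by
    have h := (hs.comp_injective (i := fun k : ℕ => (k, n)) fun i j h =>
      (Prod.ext_iff.1 h).1).hasSum
    have hv : evenZeta (n + 1) * x ^ (2 * (n + 1)) =
        ∑' k : ℕ, ((x / ((k : ℝ) + 1)) ^ 2) ^ (n + 1) := by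
      rw [evenZeta_succ, ← tsum_mul_right]
      refine tsum_congr fun k => ?_
      rw [← pow_mul, div_pow]
      ring
    rw [hv]
    exact h
  have h := hswap.prod_fiberwise hn
  rw [← hasSum_nat_add_iff' 1]
  simpa [evenZeta_zero, neg_div, sub_eq_add_neg, add_comm] using h

/-! ### The zeta series as an integral -/

lemma integral_pow_mul_one_sub_pow (m N : ℕ) :
    ∫ t in (0 : ℝ)..1, t ^ m * dividedPow N (1 - t) =
      1 / ∏ j ∈ Finset.range (N + 1), ((m + 1 + j : ℕ) : ℝ) := by
  have h := Complex.betaIntegral_eval_nat_add_one_right (u := (m + 1 : ℂ))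
    (by simp; positivity) N
  simp only [Complex.betaIntegral, add_sub_cancel_right, Complex.cpow_natCast] at h
  have h' : (∫ t in (0 : ℝ)..1, t ^ m * (1 - t) ^ N) =
      (N.factorial : ℝ) / ∏ j ∈ Finset.range (N + 1), ((m + 1 + j : ℕ) : ℝ) := by
    have h2 : (((∫ t in (0 : ℝ)..1, t ^ m * (1 - t) ^ N) : ℝ) : ℂ) =
        (((N.factorial : ℝ) / ∏ j ∈ Finset.range (N + 1), ((m + 1 + j : ℕ) : ℝ) : ℝ) : ℂ) := by
      rw [← intervalIntegral.integral_ofReal]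
      push_cast
      exact h
    exact_mod_cast h2
  have hN : (N.factorial : ℝ) ≠ 0 := by positivity
  simp only [dividedPow, ← mul_div_assoc, intervalIntegral.integral_div]
  rw [h']
  field_simp

lemma lupuTerm_eq_integral (a b n : ℕ) : lupuTerm a b n =
    ((∫ t in (0 : ℝ)..1, evenZeta n * (t / 2) ^ (2 * n) *
      (t ^ (2 * a + 1) * dividedPow (2 * b + 1) (1 - t)) : ℝ) : ℂ) := by
  have h : (fun t : ℝ => evenZeta n * (t / 2) ^ (2 * n) *
      (t ^ (2 * a + 1) * dividedPow (2 * b + 1) (1 - t))) = fun t =>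
      evenZeta n / 2 ^ (2 * n) * (t ^ (2 * n + 2 * a + 1) * dividedPow (2 * b + 1) (1 - t)) := by
    ext t
    rw [div_pow]
    ring
  have hp : ∏ j ∈ Finset.Icc (2 * n + 2 * a + 2) (2 * n + 2 * a + 2 * b + 3), (j : ℂ) =
      ((∏ j ∈ Finset.range (2 * b + 1 + 1), ((2 * n + 2 * a + 1 + 1 + j : ℕ) : ℝ) : ℝ) : ℂ) := by
    rw [← Finset.Ico_add_one_right_eq_Icc, Finset.prod_Ico_eq_prod_range]
    rw [show 2 * n + 2 * a + 2 * b + 3 + 1 - (2 * n + 2 * a + 2) = 2 * b + 1 + 1 by omega]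
    push_cast
    refine Finset.prod_congr rfl fun j _ => ?_
    ring
  rw [h, intervalIntegral.integral_const_mul, integral_pow_mul_one_sub_pow, lupuTerm, hp,
    ← ofReal_evenZeta]
  push_cast
  field_simp

lemma hasSum_lupuTerm (a b : ℕ) : HasSum (lupuTerm a b)
    ((-((2 * a + 2).factorial / (4 * π ^ (2 * a + 2 * b + 2)) * cotIntegral a b) : ℝ) : ℂ) := by
  have hlupu : lupuTerm a b = fun n => _ := funext (lupuTerm_eq_integral a b)
  rw [hlupu, Complex.hasSum_ofReal]
  have c1 := continuous_dividedPow (2 * b + 1)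
  have hhalf : ∀ t ∈ Set.Ioc (0 : ℝ) 1, t / 2 ∈ Set.Ioo (0 : ℝ) 1 := fun t ht =>
    ⟨by linarith [ht.1], by linarith [ht.2]⟩
  have hsum := intervalIntegral.hasSum_integral_of_dominated_convergence (a := 0) (b := 1)
    (μ := MeasureTheory.volume)
    (F := fun n t => evenZeta n * (t / 2) ^ (2 * n) *
      (t ^ (2 * a + 1) * dividedPow (2 * b + 1) (1 - t)))
    (f := fun t => -(π * (t / 2) / 2 * cot (π * (t / 2))) *
      (t ^ (2 * a + 1) * dividedPow (2 * b + 1) (1 - t)))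
    (fun n _ => |evenZeta n * (1 / 2) ^ (2 * n)|)
    (fun n => Continuous.aestronglyMeasurable (by fun_prop))
    (fun n => by
      refine Eventually.of_forall fun t ht => ?_
      rw [Set.uIoc_of_le zero_le_one] at ht
      have ht0 : 0 ≤ t := ht.1.le
      have h1 : |t ^ (2 * a + 1) * dividedPow (2 * b + 1) (1 - t)| ≤ 1 := by
        have h0 : 0 ≤ 1 - t := by linarith [ht.2]
        have hd0 := dividedPow_nonneg (2 * b + 1) h0
        rw [abs_of_nonneg (by positivity)]
        refine mul_le_one₀ (pow_le_one₀ ht0 ht.2) hd0 ?_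
        exact (div_le_self (by positivity)
          (by exact_mod_cast Nat.succ_le_of_lt (Nat.factorial_pos _))).trans
            (pow_le_one₀ h0 (by linarith))
      have h2 : |evenZeta n * (t / 2) ^ (2 * n)| ≤ |evenZeta n * (1 / 2) ^ (2 * n)| := by
        rw [abs_mul, abs_mul, abs_of_nonneg (by positivity : 0 ≤ (t / 2) ^ (2 * n)),
          abs_of_nonneg (by positivity : (0 : ℝ) ≤ (1 / 2) ^ (2 * n))]
        have := ht.2
        gcongr
      rw [norm_eq_abs, abs_mul]
      exact (mul_le_mul h2 h1 (abs_nonneg _) (abs_nonneg _)).trans (mul_one _).le)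
    (Eventually.of_forall fun t _ =>
      (hasSum_evenZeta_mul_pow (x := 1 / 2) (by constructor <;> norm_num)).summable.abs)
    (by simp)
    (Eventually.of_forall fun t ht => by
      rw [Set.uIoc_of_le zero_le_one] at ht
      exact (hasSum_evenZeta_mul_pow (hhalf t ht)).mul_right _)
  suffices h : -((2 * a + 2).factorial / (4 * π ^ (2 * a + 2 * b + 2)) * cotIntegral a b) =
      ∫ t in (0 : ℝ)..1, -(π * (t / 2) / 2 * cot (π * (t / 2))) *
        (t ^ (2 * a + 1) * dividedPow (2 * b + 1) (1 - t)) by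
    rw [h]
    exact hsum
  -- The substitution `t = 2x / π` turns one integral into the other.
  have hscale := intervalIntegral.integral_comp_mul_left (a := 0) (b := π / 2) (c := 2 / π)
    (fun t => -(π * (t / 2) / 2 * cot (π * (t / 2))) *
      (t ^ (2 * a + 1) * dividedPow (2 * b + 1) (1 - t))) (by positivity)
  have hpi := pi_pos.ne'
  rw [mul_zero, div_mul_div_cancel₀ hpi, div_self (two_ne_zero)] at hscale
  rw [smul_eq_mul, eq_comm, inv_mul_eq_iff_eq_mul₀ (by positivity)] at hscale
  rw [hscale, cotIntegral, ← mul_assoc, mul_comm _ (2 / π), mul_assoc, ← mul_neg,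
    ← neg_mul, ← intervalIntegral.integral_const_mul]
  congr 2
  ext x
  have hf : ((2 * a + 2).factorial : ℝ) ≠ 0 := by positivity
  have hg : ((2 * b + 1).factorial : ℝ) ≠ 0 := by positivity
  have e1 : π * (2 / π * x / 2) = x := by field_simp
  have e2 : 1 - 2 / π * x = (π - 2 * x) / π := by field_simp
  have e3 : 2 / π * x = 2 * x / π := by ring
  rw [e1, e2, e3]
  unfold dividedPow
  rw [div_pow, div_pow]
  field_simp
  ring

/-! ### Iterated tail sums and multiple zeta series -/


/-- The tail `∑ g k` over `k > m`. -/
noncomputable def tailSum (g : ℕ → ℝ≥0∞) (m : ℕ) : ℝ≥0∞ := ∑' k, if m < k then g k else 0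

/-- The weight `1 / k ^ s` as an extended nonnegative real. -/
noncomputable def invPow (s k : ℕ) : ℝ≥0∞ := ENNReal.ofReal (1 / (k : ℝ) ^ s)

open Classical in
/-- The multiple sum of `1 / (k₁ ^ s₁ ⋯ k_r ^ s_r)` over `m < k₁ < ⋯ < k_r`. -/
noncomputable def tupleSum (s : List ℕ) (m : ℕ) : ℝ≥0∞ :=
  ∑' k : Fin s.length → ℕ,
    if (∀ i, m < k i) ∧ StrictMono k then ∏ i, invPow (s.get i) (k i) else 0

lemma tailSum_eq (g : ℕ → ℝ≥0∞) (m : ℕ) : tailSum g m = ∑' j, g (m + j + 1) := by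
  rw [tailSum, ← ENNReal.summable.sum_add_tsum_nat_add' (k := m + 1), Finset.sum_eq_zero, zero_add]
  · refine tsum_congr fun j => ?_
    rw [if_pos (by omega), show j + (m + 1) = m + j + 1 by omega]
  · intro k hk
    rw [if_neg (by have := Finset.mem_range.1 hk; omega)]

lemma tupleSum_nil (m : ℕ) : tupleSum [] m = 1 := by
  have : ∀ k : Fin ([] : List ℕ).length → ℕ, StrictMono k := fun k i => i.elim0
  simp [tupleSum, this]

lemma strictMono_cons_iff {n : ℕ} (x : ℕ) (k : Fin n → ℕ) :
    StrictMono (Fin.cons x k : Fin (n + 1) → ℕ) ↔ (∀ i, x < k i) ∧ StrictMono k := by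
  constructor
  · intro h
    refine ⟨fun i => by simpa using h (Fin.succ_pos i), fun i j hij => ?_⟩
    simpa using h (Fin.succ_lt_succ_iff.2 hij)
  · rintro ⟨h0, h⟩ i j hij
    induction j using Fin.cases with
    | zero => exact absurd hij (Fin.not_lt_zero i)
    | succ j =>
      induction i using Fin.cases with
      | zero => simpa using h0 j
      | succ i => simpa using h (Fin.succ_lt_succ_iff.1 hij)

/-- Splitting off the smallest index. -/
lemma tupleSum_cons (x : ℕ) (s : List ℕ) :
    tupleSum (x :: s) = tailSum fun k => invPow x k * tupleSum s k := by
  classical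
  ext m
  rw [tailSum, tupleSum]
  refine ((Fin.consEquiv (fun _ : Fin (s.length + 1) => ℕ)).tsum_eq _).symm.trans ?_
  rw [ENNReal.tsum_prod']
  refine tsum_congr fun k₀ => ?_
  rw [tupleSum, ← ENNReal.tsum_mul_left]
  split_ifs with h
  · refine tsum_congr fun k => ?_
    have hiff : ((∀ i, m < (Fin.cons k₀ k : Fin (s.length + 1) → ℕ) i) ∧
        StrictMono (Fin.cons k₀ k : Fin (s.length + 1) → ℕ)) ↔
        (∀ i, k₀ < k i) ∧ StrictMono k := by
      rw [strictMono_cons_iff]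
      refine and_iff_right_of_imp fun h1 i => ?_
      induction i using Fin.cases with
      | zero => simpa using h
      | succ i => simpa using h.trans (h1.1 i)
    rw [mul_ite, mul_zero]
    refine (if_congr hiff ?_ rfl)
    exact Fin.prod_univ_succ _
  · rw [ENNReal.tsum_eq_zero]
    intro k
    rw [if_neg]
    exact fun h1 => h (by simpa using h1.1 0)

lemma tsum_ofReal_mzvTerm (s : List ℕ) :
    ∑' k : MZVIndex s.length, ENNReal.ofReal (mzvTerm s k) = tupleSum s 0 := by
  classical
  have h := tsum_subtype {k : Fin s.length → ℕ | (∀ i, 1 ≤ k i) ∧ StrictMono k}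
    (fun k => ∏ i, invPow (s.get i) (k i))
  rw [tupleSum]
  refine Eq.trans ?_ (h.trans ?_)
  · refine tsum_congr fun k => ?_
    simp only [invPow]
    rw [← ENNReal.ofReal_prod_of_nonneg fun i _ => by positivity, Finset.prod_div_distrib,
      Finset.prod_const_one]
    rfl
  · refine tsum_congr fun k => ?_
    simp only [Set.indicator_apply, Set.mem_ofPred_eq]
    rfl

lemma tupleSum_replicate_two (b : ℕ) :
    tupleSum (List.replicate b 2) = fun k => ENNReal.ofReal (sinMoment b k) := by
  induction b with
  | zero => ext k; simp [tupleSum_nil, sinMoment_zero_left]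
  | succ b ih =>
    ext m
    have h := hasSum_sinMoment_succ b m
    rw [List.replicate_succ, tupleSum_cons, ih, tailSum_eq, ← h.tsum_eq,
      ENNReal.ofReal_tsum_of_nonneg
        (fun j => div_nonneg (sinMoment_nonneg b _) (by positivity)) h.summable]
    refine tsum_congr fun j => ?_
    rw [invPow, ← ENNReal.ofReal_mul (by positivity)]
    congr 1
    ring

lemma tupleSum_replicate_two_append (a : ℕ) (s : List ℕ) :
    tupleSum (List.replicate a 2 ++ s) =
      (fun f => tailSum fun k => invPow 2 k * f k)^[a] (tupleSum s) := by
  induction a with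
  | zero => rfl
  | succ a ih =>
    rw [List.replicate_succ, List.cons_append, tupleSum_cons, ih, Function.iterate_succ_apply']

/-- Collecting the iterated tail sums of `g` according to the index of `g`. -/
lemma iterate_tailSum (a : ℕ) (g : ℕ → ℝ≥0∞) :
    (fun f => tailSum fun k => invPow 2 k * f k)^[a] (tailSum g) 0 =
      ∑' k, ENNReal.ofReal (headSum a k) * g (k + 1) := by
  induction a generalizing g with
  | zero => simp [tailSum_eq, headSum]
  | succ a ih =>
    rw [Function.iterate_succ_apply, ih]
    have h : ∀ k, tailSum g (k + 1) = ∑' l, if k < l then g (l + 1) else 0 := fun k => by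
      rw [tailSum, tsum_eq_zero_add' ENNReal.summable]
      simp
    simp only [h, ← ENNReal.tsum_mul_left]
    rw [ENNReal.tsum_comm]
    refine tsum_congr fun l => ?_
    rw [tsum_eq_sum (s := Finset.range l) fun k hk => by
      rw [if_neg (by simpa using hk), mul_zero, mul_zero]]
    rw [headSum, ENNReal.ofReal_sum_of_nonneg
      fun j _ => div_nonneg (headSum_nonneg a j) (by positivity), Finset.sum_mul]
    refine Finset.sum_congr rfl fun k hk => ?_
    rw [if_pos (Finset.mem_range.1 hk), ← mul_assoc, invPow,
      ← ENNReal.ofReal_mul (headSum_nonneg a k), mul_one_div]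
    push_cast
    rfl

lemma tsum_ofReal_mzvTerm_twosThreeTwos (a b : ℕ) :
    ∑' k, ENNReal.ofReal (mzvTerm (twosThreeTwos a b) k) = ENNReal.ofReal (cotIntegral a b) := by
  have h := hasSum_headSum_mul_sinMoment a b
  rw [tsum_ofReal_mzvTerm, twosThreeTwos, List.append_assoc, tupleSum_replicate_two_append,
    List.singleton_append, tupleSum_cons, tupleSum_replicate_two, iterate_tailSum, ← h.tsum_eq,
    ENNReal.ofReal_tsum_of_nonneg (fun k => mul_nonneg (headSum_nonneg a k)
      (div_nonneg (sinMoment_nonneg b _) (by positivity))) h.summable]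
  refine tsum_congr fun k => ?_
  rw [ENNReal.ofReal_mul (headSum_nonneg a k), invPow, ← ENNReal.ofReal_mul (by positivity)]
  congr 2
  push_cast
  ring

lemma hasSum_mzvTerm (a b : ℕ) : HasSum (mzvTerm (twosThreeTwos a b)) (cotIntegral a b) := by
  have h := tsum_ofReal_mzvTerm_twosThreeTwos a b
  have hnn : ∀ k, 0 ≤ mzvTerm (twosThreeTwos a b) k := fun k => by unfold mzvTerm; positivity
  have h0 : 0 ≤ cotIntegral a b := (hasSum_headSum_mul_sinMoment a b).nonneg fun k =>
    mul_nonneg (headSum_nonneg a k) (div_nonneg (sinMoment_nonneg b _) (by positivity))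
  have hs := ENNReal.hasSum_toReal (f := fun k => ENNReal.ofReal (mzvTerm (twosThreeTwos a b) k))
    (by rw [h]; exact ENNReal.ofReal_ne_top)
  rw [← ENNReal.tsum_toReal_eq fun _ => ENNReal.ofReal_ne_top, h, ENNReal.toReal_ofReal h0] at hs
  simpa only [ENNReal.toReal_ofReal (hnn _)] using hs

/-- Both the series defining `ζ({2}^a, 3, {2}^b)` and the series on the right converge, and the
stated identity holds between their sums. -/
theorem theorem1p1 (a b : ℕ) :
    Summable (mzvTerm (twosThreeTwos a b)) ∧
    Summable (lupuTerm a b) ∧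
    ((multipleZeta (twosThreeTwos a b) : ℝ) : ℂ) =
      -4 * (Real.pi : ℂ) ^ (2 * a + 2 * b + 2) / (Nat.factorial (2 * a + 2) : ℂ) *
        ∑' n : ℕ, lupuTerm a b n := by
  refine ⟨(hasSum_mzvTerm a b).summable, (hasSum_lupuTerm a b).summable, ?_⟩
  have hpi : (π : ℂ) ≠ 0 := by exact_mod_cast pi_pos.ne'
  have hf : ((2 * a + 2).factorial : ℂ) ≠ 0 := by exact_mod_cast (Nat.factorial_pos _).ne'
  rw [multipleZeta, (hasSum_mzvTerm a b).tsum_eq, (hasSum_lupuTerm a b).tsum_eq]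
  push_cast
  field_simp
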